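/- Conventions. A linear factorisation of an element $W$ of a commutative ring $R$ is a $\mathbb{Z}/2$-graded $R$-module $X=X^0\oplus X^1$ with an odd $R$-linear map $d_X$ such that $d_X^2=W\cdot 1_X$. It is a finite rank matrix factorisation if $X^0,X^1$ are free of finite rank. $\mathrm{HF}(R,W)$ is the homotopy category of linear factorisations (morphisms: even $R$-linear maps commuting with the differentials, modulo maps $d_Yh+hd_X$ with $h$ odd), and $\mathrm{hmf}(R,W)$ is its full subcategory of finite rank matrix factorisations. Tensor products carry $d(x\otimes y)=dx\otimes y+(-1)^{|x|}x\otimes dy$, $\operatorname{Hom}(X,Y)$ carries $d\alpha=d_Y\alpha-(-1)^{|\alpha|}\alpha d_X$, and $X^\vee=\operatorname{Hom}_R(X,R)$ is a factorisation of $-W$ with $d\nu=-(-1)^{|\nu|}\nu\circ d_X$. The supertrace is $\operatorname{str}(\alpha)=\operatorname{tr}(G\alpha)$, where $G(x)=(-1)^{|x|}x$. Proposition (Knörrer periodicity, natural isomorphism $\kappa$). Let $S$ be a commutative $\mathbb{Q}$-algebra, $W\in S$, $R=S[[u,v]]$ and $\varphi:S\to R$ the inclusion. Let $K$ be the Koszul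 factorisation of $uv$ over $R$: free with one even and one odd basis vector and $$d_K=\begin{pmatrix}0&u\\ v&0\end{pmatrix}.$$ Consider the functors $$\Phi:\mathrm{hmf}(S,W)\to\mathrm{hmf}(S[[u,v]],W+uv),\qquad \Phi(X)=X\otimes_S K,$$ $$\Psi:\mathrm{hmf}(S[[u,v]],W+uv)\to\mathrm{HF}(S,W),\qquad \Psi(Y)=\varphi_*(Y\otimes_R K^\vee),$$ where $\varphi_*$ is restriction of scalars. There is a canonical isomorphism of linear factorisations $\Psi\Phi(X)=X\otimes K\otimes K^\vee\cong X\otimes_S\operatorname{Hom}_R(K,K)$, $x\otimes k\otimes\nu\mapsto x\otimes\nu(-)k$, natural in $X$. Identifying along it, there is an isomorphism in $\mathrm{HF}(S,W)$, natural in $X\in\mathrm{hmf}(S,W)$, $$\kappa:\ \Psi\Phi(X)=X\otimes_S\operatorname{Hom}_R(K,K)\longrightarrow X,$$ represented by the morphism of linear factorisations given for $x\in X$ and $\alpha\in\operatorname{Hom}_R(K,K)$ by $$\kappa(x\otimes\alpha)=\operatorname{Res}_{S[[u,v]]/S}\begin{bmatrix}\operatorname{str}\big(\alpha\,\partial_v(d_K)\,\partial_u(d_K)\big)\cdot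 du\wedge dv\\ u,\,v\end{bmatrix}\cdot x .$$ Here $\partial_u(d_K),\partial_v(d_K)$ are entrywise derivatives. For $f,r_1,r_2\in R$ the residue symbol $\operatorname{Res}_{S[[u,v]]/S}\begin{bmatrix} f\cdot dr_1\wedge dr_2\\ u,\,v\end{bmatrix}$ is the trace over $S$ of the endomorphism of $R/(u,v)R$ induced by $f\big([\partial_u,r_1][\partial_v,r_2]-[\partial_v,r_1][\partial_u,r_2]\big)$. -/

import Mathlib

open CategoryTheory TensorProduct

universe u

noncomputable section

namespace Knorrer

/-- A linear factorisation of `W` over `R`.  The `ℤ/2`-grading `M = M⁰ ⊕ M¹` is recorded by the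
projection `p` onto the even part, so that `M⁰ = range p` and `M¹ = ker p`; the differential `d`
is odd and squares to `W`. -/
structure LinFact (R : Type u) [CommRing R] (W : R) where
  M : Type u
  [addCommGroup : AddCommGroup M]
  [module : Module R M]
  p : Module.End R M
  d : Module.End R M
  p_idem : p * p = p
  d_odd : p * d = d * (1 - p)
  d_sq : d * d = W • (1 : Module.End R M)

attribute [instance] LinFact.addCommGroup LinFact.module

namespace LinFact

section Basic

variable {R : Type u} [CommRing R] {W : R}

/-- The even part `X⁰`. -/
def even (X : LinFact R W) : Submodule R X.M := LinearMap.range X.p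

/-- The odd part `X¹`. -/
def odd (X : LinFact R W) : Submodule R X.M := LinearMap.ker X.p

/-- The grading operator `G(x) = (-1)^{|x|} x`. -/
def G (X : LinFact R W) : Module.End R X.M := X.p - (1 - X.p)

theorem p_p (X : LinFact R W) (x : X.M) : X.p (X.p x) = X.p x :=
  LinearMap.congr_fun X.p_idem x

theorem p_d (X : LinFact R W) (x : X.M) : X.p (X.d x) = X.d x - X.d (X.p x) := by
  have := LinearMap.congr_fun X.d_odd x
  simpa using this

theorem d_d (X : LinFact R W) (x : X.M) : X.d (X.d x) = W • x :=
  LinearMap.congr_fun X.d_sq x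

theorem G_apply (X : LinFact R W) (x : X.M) : X.G x = X.p x - (x - X.p x) := rfl

/-- A morphism of linear factorisations: an even `R`-linear map commuting with the differentials,
that is, a cocycle of degree zero in `Hom_R(X, Y)`. -/
@[ext]
structure Hom (X Y : LinFact R W) where
  hom : X.M →ₗ[R] Y.M
  comm_p : Y.p ∘ₗ hom = hom ∘ₗ X.p
  comm_d : Y.d ∘ₗ hom = hom ∘ₗ X.d

theorem Hom.p_hom {X Y : LinFact R W} (f : Hom X Y) (x : X.M) : Y.p (f.hom x) = f.hom (X.p x) :=
  LinearMap.congr_fun f.comm_p x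

theorem Hom.d_hom {X Y : LinFact R W} (f : Hom X Y) (x : X.M) : Y.d (f.hom x) = f.hom (X.d x) :=
  LinearMap.congr_fun f.comm_d x

/-- The category of linear factorisations of `W` over `R`, with morphisms taken on the nose. -/
instance category : Category (LinFact R W) where
  Hom X Y := Hom X Y
  id X := ⟨LinearMap.id, rfl, rfl⟩
  comp f g := ⟨g.hom ∘ₗ f.hom,
    by ext x; simp [Hom.p_hom], by ext x; simp [Hom.d_hom]⟩

@[simp] theorem id_hom (X : LinFact R W) : Hom.hom (𝟙 X) = LinearMap.id := rfl

@[simp] theorem comp_hom {X Y Z : LinFact R W} (f : X ⟶ Y) (g : Y ⟶ Z) :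
    (f ≫ g).hom = g.hom ∘ₗ f.hom := rfl

theorem hom_ext {X Y : LinFact R W} {f g : X ⟶ Y} (h : f.hom = g.hom) : f = g := Hom.ext h

/-- Two morphisms are homotopic when their difference is a coboundary `d h + h d` with `h` odd. -/
def homotopic (R : Type u) [CommRing R] (W : R) : HomRel (LinFact R W) := fun X Y f g =>
  ∃ h : X.M →ₗ[R] Y.M, Y.p ∘ₗ h = h ∘ₗ (1 - X.p) ∧ f.hom - g.hom = Y.d ∘ₗ h + h ∘ₗ X.d

instance congruence (R : Type u) [CommRing R] (W : R) : Congruence (homotopic R W) where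
  equivalence := by
    intro X Y
    refine ⟨fun f => ⟨0, by simp, by simp⟩, ?_, ?_⟩
    · rintro f g ⟨h, h1, h2⟩
      refine ⟨-h, by simp [h1, LinearMap.comp_neg, LinearMap.neg_comp], ?_⟩
      rw [← neg_sub, h2]
      simp [LinearMap.comp_neg, LinearMap.neg_comp]
      abel
    · rintro f g k ⟨h, h1, h2⟩ ⟨h', h1', h2'⟩
      refine ⟨h + h', by simp [h1, h1', LinearMap.comp_add, LinearMap.add_comp], ?_⟩
      rw [← sub_add_sub_cancel f.hom g.hom k.hom, h2, h2']
      simp [LinearMap.comp_add, LinearMap.add_comp]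
      abel
  comp_left := by
    rintro X Y Z f g g' ⟨h, h1, h2⟩
    refine ⟨h ∘ₗ f.hom, ?_, ?_⟩
    · ext x
      have := LinearMap.congr_fun h1 (f.hom x)
      simp at this
      simp [this, Hom.p_hom]
    · ext x
      have := LinearMap.congr_fun h2 (f.hom x)
      simp at this
      simp [this, Hom.d_hom]
  comp_right := by
    rintro X Y Z f f' g ⟨h, h1, h2⟩
    refine ⟨g.hom ∘ₗ h, ?_, ?_⟩
    · ext x
      have := LinearMap.congr_fun h1 x
      simp at this
      simp [this, Hom.p_hom]
    · ext x
      have := LinearMap.congr_fun h2 x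
      simp at this
      simp [← map_sub, this, Hom.d_hom]

end Basic

section Constructions

variable {R : Type u} [CommRing R]

/-- The `ℤ/2`-graded tensor product `X ⊗ Y`, a factorisation of `U = W + V`, with differential
`d(x ⊗ y) = d x ⊗ y + (-1)^{|x|} x ⊗ d y`. -/
abbrev tensor {W V U : R} (h : W + V = U) (X : LinFact R W) (Y : LinFact R V) : LinFact R U where
  M := X.M ⊗[R] Y.M
  p := TensorProduct.map X.p Y.p + TensorProduct.map (1 - X.p) (1 - Y.p)
  d := TensorProduct.map X.d 1 + TensorProduct.map X.G Y.d
  p_idem := by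
    ext x y
    simp [p_p, tmul_sub, sub_tmul]
  d_odd := by
    ext x y
    simp [p_p, p_d, G_apply, tmul_sub, sub_tmul]
    abel
  d_sq := by
    subst h
    ext x y
    simp [p_p, p_d, d_d, G_apply, sub_tmul, smul_sub, add_smul, smul_tmul']
    abel

/-- The functor `- ⊗ Y`. -/
abbrev tensorRight {W V U : R} (h : W + V = U) (Y : LinFact R V) : LinFact R W ⥤ LinFact R U where
  obj X := tensor h X Y
  map {X X'} f :=
    { hom := LinearMap.rTensor Y.M f.hom
      comm_p := by
        ext x y
        simp [tensor, Hom.p_hom, sub_tmul, tmul_sub]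
      comm_d := by
        ext x y
        simp [tensor, Hom.p_hom, Hom.d_hom, G_apply, sub_tmul] }
  map_id X := hom_ext (LinearMap.rTensor_id _ _)
  map_comp f g := hom_ext (LinearMap.rTensor_comp _ _ _)

theorem tensorRight_homotopic {W V U : R} (h : W + V = U) (Y : LinFact R V) {X X' : LinFact R W}
    {f g : X ⟶ X'} (H : homotopic R W f g) :
    homotopic R U ((tensorRight h Y).map f) ((tensorRight h Y).map g) := by
  obtain ⟨k, h1, h2⟩ := H
  refine ⟨LinearMap.rTensor Y.M k, ?_, ?_⟩
  · refine TensorProduct.ext' fun x y => ?_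
    have := LinearMap.congr_fun h1 x
    simp at this
    simp [tensorRight, tensor, this, sub_tmul, tmul_sub]
    abel
  · refine TensorProduct.ext' fun x y => ?_
    have e1 := LinearMap.congr_fun h1 x
    have e2 := LinearMap.congr_fun h2 x
    simp at e1 e2
    simp [tensorRight, tensor, ← sub_tmul, e2]
    simp [G_apply, e1, sub_tmul, add_tmul]
    abel

/-- Base change `R ⊗_S X` of a factorisation along `S → R`. -/
abbrev baseChange {S : Type u} [CommRing S] [Algebra S R] {W : S} (X : LinFact S W) :
    LinFact R (algebraMap S R W) where
  M := R ⊗[S] X.M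
  p := X.p.baseChange R
  d := X.d.baseChange R
  p_idem := by ext x; simp [p_p]
  d_odd := by ext x; simp [p_d, tmul_sub]
  d_sq := by ext x; simp [d_d]

/-- The base change functor. -/
abbrev baseChangeFunctor (R : Type u) [CommRing R] {S : Type u} [CommRing S] [Algebra S R] (W : S) :
    LinFact S W ⥤ LinFact R (algebraMap S R W) where
  obj X := X.baseChange
  map {X X'} f :=
    { hom := f.hom.baseChange R
      comm_p := by ext x; simp [baseChange, Hom.p_hom]
      comm_d := by ext x; simp [baseChange, Hom.d_hom] }
  map_id X := hom_ext LinearMap.baseChange_id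
  map_comp f g := hom_ext (LinearMap.baseChange_comp _ _)

theorem baseChange_homotopic {S : Type u} [CommRing S] [Algebra S R] {W : S} {X X' : LinFact S W}
    {f g : X ⟶ X'} (H : homotopic S W f g) :
    homotopic R _ ((baseChangeFunctor R W).map f) ((baseChangeFunctor R W).map g) := by
  obtain ⟨k, h1, h2⟩ := H
  refine ⟨k.baseChange R, ?_, ?_⟩
  · refine TensorProduct.AlgebraTensorModule.ext fun r x => ?_
    have := LinearMap.congr_fun h1 x
    simp at this
    simp [baseChangeFunctor, baseChange, this, tmul_sub]
  · refine TensorProduct.AlgebraTensorModule.ext fun r x => ?_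
    have := LinearMap.congr_fun h2 x
    simp at this
    simp [baseChangeFunctor, baseChange, ← tmul_sub, ← tmul_add, this]

section Pushforward

variable {S : Type u} [CommRing S] [Algebra S R]

/-- The pushforward (restriction of scalars) `φ_*` along `φ : S → R`: the same graded abelian group
and differential, with `S` acting through `φ`. -/
def pushforward {W : S} {V : R} (h : algebraMap S R W = V) (X : LinFact R V) : LinFact S W :=
  letI : Module S X.M := Module.compHom X.M (algebraMap S R)
  { M := X.M
    p := { toFun := X.p, map_add' := map_add X.p, map_smul' := fun s => map_smul X.p (algebraMap S R s) }
    d := { toFun := X.d, map_add' := map_add X.d, map_smul' := fun s => map_smul X.d (algebraMap S R s) }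
    p_idem := LinearMap.ext fun x => X.p_p x
    d_odd := LinearMap.ext fun x =>
      (X.p_d x).trans (map_sub X.d x (X.p x)).symm
    d_sq := LinearMap.ext fun x => by
      subst h
      exact X.d_d x }

/-- The identity map from (the underlying group of) `X` to that of `φ_*(X)`. -/
def toPush {W : S} {V : R} (h : algebraMap S R W = V) (X : LinFact R V) :
    X.M ≃+ (pushforward h X).M := AddEquiv.refl X.M

theorem toPush_smul {W : S} {V : R} (h : algebraMap S R W = V) (X : LinFact R V) (s : S)
    (x : X.M) : toPush h X (algebraMap S R s • x) = s • toPush h X x := rfl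

theorem toPush_p {W : S} {V : R} (h : algebraMap S R W = V) (X : LinFact R V) (x : X.M) :
    (pushforward h X).p (toPush h X x) = toPush h X (X.p x) := rfl

theorem toPush_d {W : S} {V : R} (h : algebraMap S R W = V) (X : LinFact R V) (x : X.M) :
    (pushforward h X).d (toPush h X x) = toPush h X (X.d x) := rfl

/-- An `R`-linear map, regarded as an `S`-linear map between pushforwards. -/
def pushMap {W : S} {V : R} (h : algebraMap S R W = V) {X Y : LinFact R V} (f : X.M →ₗ[R] Y.M) :
    (pushforward h X).M →ₗ[S] (pushforward h Y).M where
  toFun x := toPush h Y (f ((toPush h X).symm x))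
  map_add' x y := map_add f ((toPush h X).symm x) ((toPush h X).symm y)
  map_smul' s x := map_smul f (algebraMap S R s) ((toPush h X).symm x)

/-- The pushforward functor. -/
def pushforwardFunctor {W : S} {V : R} (h : algebraMap S R W = V) :
    LinFact R V ⥤ LinFact S W where
  obj X := pushforward h X
  map {X _} f :=
    { hom := pushMap h f.hom
      comm_p := LinearMap.ext fun x => f.p_hom ((toPush h X).symm x)
      comm_d := LinearMap.ext fun x => f.d_hom ((toPush h X).symm x) }
  map_id _ := rfl
  map_comp _ _ := rfl

theorem pushforward_homotopic {W : S} {V : R} (h : algebraMap S R W = V) {X X' : LinFact R V}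
    {f g : X ⟶ X'} (H : homotopic R V f g) :
    homotopic S W ((pushforwardFunctor h).map f) ((pushforwardFunctor h).map g) := by
  obtain ⟨k, h1, h2⟩ := H
  exact ⟨pushMap h k, LinearMap.ext fun x => LinearMap.congr_fun h1 ((toPush h X).symm x),
    LinearMap.ext fun x => LinearMap.congr_fun h2 ((toPush h X).symm x)⟩

end Pushforward

/-- The dual factorisation `X^∨`: the even part consists of the functionals vanishing on `X¹`, and
`d ν = -(-1)^{|ν|} ν ∘ d`, that is, `d_{X^∨}` has components `(d⁰)^*` and `-(d¹)^*`. -/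
abbrev dual {W : R} (X : LinFact R W) : LinFact R (-W) where
  M := Module.Dual R X.M
  p := Module.Dual.transpose X.p
  d := - Module.Dual.transpose (X.G * X.d)
  p_idem := by
    ext ν x
    simp [Module.Dual.transpose_apply, p_p]
  d_odd := by
    ext ν x
    simp [Module.Dual.transpose_apply, p_p, p_d, G_apply]
    try abel
  d_sq := by
    ext ν x
    simp [Module.Dual.transpose_apply, p_p, p_d, d_d, G_apply]
    try abel

/-- The factorisation `Hom_R(X, Y)` of zero, with `d α = d_Y ∘ α - (-1)^{|α|} α ∘ d_X`;
note that `G_Y ∘ α ∘ G_X = (-1)^{|α|} α`. -/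
abbrev homFact {W : R} (X Y : LinFact R W) : LinFact R (0 : R) where
  M := X.M →ₗ[R] Y.M
  p := LinearMap.lcomp R Y.M X.p ∘ₗ LinearMap.llcomp R X.M Y.M Y.M Y.p +
    LinearMap.lcomp R Y.M (1 - X.p) ∘ₗ LinearMap.llcomp R X.M Y.M Y.M (1 - Y.p)
  d := LinearMap.llcomp R X.M Y.M Y.M Y.d -
    LinearMap.lcomp R Y.M (X.G * X.d) ∘ₗ LinearMap.llcomp R X.M Y.M Y.M Y.G
  p_idem := by
    ext α x
    simp [p_p]
  d_odd := by
    ext α x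
    simp [p_p, p_d, G_apply]
    abel
  d_sq := by
    ext α x
    simp [p_p, p_d, d_d, G_apply]
    abel

end Constructions

section FiniteRank

variable {R : Type u} [CommRing R]

/-- A finite rank matrix factorisation: `X⁰` and `X¹` are free and finitely generated. -/
def IsFiniteRank {W : R} (X : LinFact R W) : Prop :=
  (Module.Free R X.even ∧ Module.Finite R X.even) ∧ (Module.Free R X.odd ∧ Module.Finite R X.odd)

theorem range_free_finite {M : Type u} [AddCommGroup M] [Module R M] {ι : Type u} [Finite ι]
    (b : Module.Basis ι R M) (q : Module.End R M) (hq : ∀ i, q (b i) = b i ∨ q (b i) = 0) :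
    Module.Free R (LinearMap.range q) ∧ Module.Finite R (LinearMap.range q) := by
  have e : LinearMap.range q =
      Submodule.span R (Set.range fun i : {i // q (b i) = b i} => b i) := by
    apply le_antisymm
    · rw [LinearMap.range_eq_map, ← b.span_eq, Submodule.map_span, Submodule.span_le]
      rintro _ ⟨_, ⟨i, rfl⟩, rfl⟩
      rcases hq i with h | h
      · rw [SetLike.mem_coe, h]
        exact Submodule.subset_span ⟨⟨i, h⟩, rfl⟩
      · rw [SetLike.mem_coe, h]
        exact Submodule.zero_mem _
    · rw [Submodule.span_le]
      rintro _ ⟨⟨i, h⟩, rfl⟩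
      exact ⟨b i, h⟩
  have li : LinearIndependent R (fun i : {i // q (b i) = b i} => b i) :=
    b.linearIndependent.comp _ Subtype.val_injective
  rw [e]
  exact ⟨Module.Free.of_basis (Module.Basis.span li),
    Module.Finite.of_basis (Module.Basis.span li)⟩

/-- `X` has finite rank if and only if it has a finite homogeneous basis. -/
theorem isFiniteRank_iff {W : R} (X : LinFact R W) : X.IsFiniteRank ↔
    ∃ (ι : Type u) (_ : Finite ι) (b : Module.Basis ι R X.M),
      ∀ i, X.p (b i) = b i ∨ X.p (b i) = 0 := by
  constructor
  · rintro ⟨⟨_, _⟩, ⟨_, _⟩⟩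
    have hc : IsCompl X.even X.odd := LinearMap.IsIdempotentElem.isCompl X.p_idem
    let b := ((Module.Free.chooseBasis R X.even).prod (Module.Free.chooseBasis R X.odd)).map
      (Submodule.prodEquivOfIsCompl _ _ hc)
    refine ⟨_, inferInstance, b, ?_⟩
    rintro (i | i)
    · left
      have h : ∀ y ∈ X.even, X.p y = y := by
        rintro _ ⟨z, rfl⟩
        exact X.p_p z
      simpa [b] using h _ (Module.Free.chooseBasis R X.even i).2
    · right
      simpa [b] using LinearMap.mem_ker.1 (Module.Free.chooseBasis R X.odd i).2
  · rintro ⟨ι, _, b, hb⟩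
    refine ⟨range_free_finite b X.p hb, ?_⟩
    have e : X.odd = LinearMap.range (1 - X.p : Module.End R X.M) := by
      ext x
      constructor
      · intro hx
        exact ⟨x, by simp [LinearMap.mem_ker.1 hx]⟩
      · rintro ⟨y, rfl⟩
        simp [odd, p_p]
    rw [e]
    refine range_free_finite b _ fun i => ?_
    rcases hb i with h | h <;> simp [h]

theorem IsFiniteRank.tensor {W V U : R} (h : W + V = U) {X : LinFact R W} {Y : LinFact R V}
    (hX : X.IsFiniteRank) (hY : Y.IsFiniteRank) : (LinFact.tensor h X Y).IsFiniteRank := by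
  rw [isFiniteRank_iff] at hX hY ⊢
  obtain ⟨ι, _, b, hb⟩ := hX
  obtain ⟨κ, _, c, hc⟩ := hY
  refine ⟨ι × κ, inferInstance, b.tensorProduct c, ?_⟩
  rintro ⟨i, j⟩
  rcases hb i with h1 | h1 <;> rcases hc j with h2 | h2 <;> simp [h1, h2]

theorem IsFiniteRank.baseChange {S : Type u} [CommRing S] [Algebra S R] {W : S} {X : LinFact S W}
    (hX : X.IsFiniteRank) : (LinFact.baseChange (R := R) X).IsFiniteRank := by
  rw [isFiniteRank_iff] at hX ⊢
  obtain ⟨ι, _, b, hb⟩ := hX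
  refine ⟨ι, inferInstance, b.baseChange R, fun i => ?_⟩
  rcases hb i with h | h <;> simp [h]

end FiniteRank

/-- The supertrace of an endomorphism `α` of the underlying module: the trace of `G ∘ α`. -/
def supertrace {R : Type u} [CommRing R] {W : R} (X : LinFact R W) (α : Module.End R X.M) : R :=
  LinearMap.trace R X.M (X.G * α)

end LinFact

/-- The homotopy category `HF(R, W)` of linear factorisations of `W` over `R`. -/
abbrev HF (R : Type u) [CommRing R] (W : R) := CategoryTheory.Quotient (LinFact.homotopic R W)

/-- The functor sending a morphism of factorisations to its homotopy class. -/
abbrev HF.quot (R : Type u) [CommRing R] (W : R) : LinFact R W ⥤ HF R W :=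
  CategoryTheory.Quotient.functor (LinFact.homotopic R W)

/-- The functor of homotopy categories induced by a functor of factorisations that preserves
homotopies. -/
abbrev HF.induced {R : Type u} [CommRing R] {W : R} {S : Type u} [CommRing S] {V : S}
    (F : LinFact R W ⥤ LinFact S V)
    (hF : ∀ {X Y : LinFact R W} {f g : X ⟶ Y}, LinFact.homotopic R W f g →
      LinFact.homotopic S V (F.map f) (F.map g)) : HF R W ⥤ HF S V :=
  CategoryTheory.Quotient.lift _ (F ⋙ HF.quot S V)
    fun _ _ _ _ h => CategoryTheory.Quotient.sound _ (hF h)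

/-- The objects of `HF(R, W)` that are finite rank matrix factorisations. -/
abbrev finiteRank (R : Type u) [CommRing R] (W : R) : ObjectProperty (HF R W) :=
  fun X => X.as.IsFiniteRank

/-- The homotopy category `hmf(R, W)` of finite rank matrix factorisations, a full subcategory of
`HF(R, W)`. -/
abbrev hmf (R : Type u) [CommRing R] (W : R) := (finiteRank R W).FullSubcategory

section Koszul

variable {R : Type u} [CommRing R]

/-- The matrix of the differential of the Koszul factorisation of `uv`. -/
def koszulMatrix (u v : R) : Matrix (Fin 2) (Fin 2) R := !![0, u; v, 0]

/-- The Koszul factorisation of `uv`: the free module with even basis vector `e₀` and odd basis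
vector `e₁`, and `d e₀ = v e₁`, `d e₁ = u e₀`. -/
abbrev koszul (u v : R) : LinFact R (u * v) where
  M := Fin 2 → R
  p := Matrix.toLin' !![1, 0; 0, 0]
  d := Matrix.toLin' (koszulMatrix u v)
  p_idem := by
    refine LinearMap.ext fun x => ?_
    ext i
    fin_cases i <;> simp
  d_odd := by
    refine LinearMap.ext fun x => ?_
    ext i
    fin_cases i <;> simp [koszulMatrix, Matrix.vecHead, Matrix.vecTail, mul_comm]
  d_sq := by
    refine LinearMap.ext fun x => ?_
    ext i
    fin_cases i <;> simp [koszulMatrix, Matrix.vecHead, Matrix.vecTail] <;> ring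

theorem koszul_isFiniteRank (u v : R) : (koszul u v).IsFiniteRank := by
  rw [LinFact.isFiniteRank_iff]
  refine ⟨ULift (Fin 2), inferInstance, (Pi.basisFun R (Fin 2)).reindex Equiv.ulift.symm, ?_⟩
  rintro ⟨i⟩
  fin_cases i
  · left
    ext j
    fin_cases j <;> simp
  · right
    ext j
    fin_cases j <;> simp <;> rfl

end Koszul

section Residue

open MvPowerSeries

variable {S : Type u} [CommRing S]

/-- The ideal `(t₁, …, tₙ)` of `S⟦t₁, …, tₙ⟧`. -/
abbrev varIdeal (S : Type u) [CommRing S] (n : ℕ) : Ideal (MvPowerSeries (Fin n) S) :=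
  Ideal.span (Set.range fun i => (MvPowerSeries.X i : MvPowerSeries (Fin n) S))

/-- The commutator `[∂/∂tᵢ, r]` as an `S`-linear operator on `S⟦t₁, …, tₙ⟧`. -/
def pderivComm {n : ℕ} (i : Fin n) (r : MvPowerSeries (Fin n) S) :
    Module.End S (MvPowerSeries (Fin n) S) :=
  (pderiv S i).toLinearMap * LinearMap.mulLeft S r - LinearMap.mulLeft S r * (pderiv S i).toLinearMap

theorem pderivComm_apply {n : ℕ} (i : Fin n) (r a : MvPowerSeries (Fin n) S) :
    pderivComm i r a = pderiv S i r * a := by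
  simp [pderivComm]
  ring

/-- The operator induced by `[∂/∂tᵢ, r]` on `S⟦t₁, …, tₙ⟧ / (t₁, …, tₙ)`. -/
def quotComm {n : ℕ} (i : Fin n) (r : MvPowerSeries (Fin n) S) :
    Module.End S (MvPowerSeries (Fin n) S ⧸ varIdeal S n) :=
  Submodule.mapQ ((varIdeal S n).restrictScalars S) ((varIdeal S n).restrictScalars S)
    (pderivComm i r) fun a ha => by
      simpa [pderivComm_apply] using Ideal.mul_mem_left _ _ ha

/-- The residue symbol of the form `s dr₁ ⋯ drₙ` with denominators `t₁, …, tₙ`, for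
`S⟦t₁, …, tₙ⟧ / S`: the trace over `S` of the endomorphism of `S⟦t⟧ / (t)` induced by
`s [∇, r₁] ⋯ [∇, rₙ]`, where `∇ = ∑ ∂/∂tⱼ dtⱼ`; collecting the coefficient of `dt₁ ∧ ⋯ ∧ dtₙ`
gives `∑_τ sgn(τ) s [∂/∂t_{τ(1)}, r₁] ⋯ [∂/∂t_{τ(n)}, rₙ]`. -/
def residue {n : ℕ} (s : MvPowerSeries (Fin n) S) (r : Fin n → MvPowerSeries (Fin n) S) : S :=
  LinearMap.trace S (MvPowerSeries (Fin n) S ⧸ varIdeal S n)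
    (∑ τ : Equiv.Perm (Fin n), (Equiv.Perm.sign τ : ℤ) •
      (LinearMap.mulLeft S (Ideal.Quotient.mk (varIdeal S n) s) *
        (List.ofFn fun i => quotComm (τ i) (r i)).prod))

end Residue

section Periodicity

variable (S : Type u) [CommRing S]

/-- The ring `S⟦u, v⟧`. -/
abbrev PS : Type u := MvPowerSeries (Fin 2) S

/-- The variable `u`. -/
abbrev uVar : PS S := MvPowerSeries.X 0

/-- The variable `v`. -/
abbrev vVar : PS S := MvPowerSeries.X 1

/-- The Koszul factorisation `K` of `uv` over `S⟦u, v⟧`. -/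
abbrev K : LinFact (PS S) (uVar S * vVar S) := koszul (uVar S) (vVar S)

/-- `∂_u(d_K)`, the entrywise derivative of the matrix of `d_K`. -/
def dKu : Module.End (PS S) (K S).M :=
  Matrix.toLin' ((koszulMatrix (uVar S) (vVar S)).map (MvPowerSeries.pderiv S 0))

/-- `∂_v(d_K)`, the entrywise derivative of the matrix of `d_K`. -/
def dKv : Module.End (PS S) (K S).M :=
  Matrix.toLin' ((koszulMatrix (uVar S) (vVar S)).map (MvPowerSeries.pderiv S 1))

variable {S} (W : S)

/-- The potential `W + uv` on `S⟦u, v⟧`. -/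
abbrev Wuv : PS S := algebraMap S (PS S) W + uVar S * vVar S

/-- The functor `X ↦ X ⊗_S K = (S⟦u, v⟧ ⊗_S X) ⊗ K` on factorisations. -/
abbrev chainPhi : LinFact S W ⥤ LinFact (PS S) (Wuv W) :=
  LinFact.baseChangeFunctor (PS S) W ⋙ LinFact.tensorRight rfl (K S)

/-- The functor `Y ↦ Y ⊗ K^∨` on factorisations. -/
abbrev tensorDual : LinFact (PS S) (Wuv W) ⥤ LinFact (PS S) (algebraMap S (PS S) W) :=
  LinFact.tensorRight (add_neg_cancel_right (algebraMap S (PS S) W) (uVar S * vVar S))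
    (LinFact.dual (K S))

/-- The functor `Y ↦ φ_*(Y ⊗ K^∨)` on factorisations. -/
abbrev chainPsi : LinFact (PS S) (Wuv W) ⥤ LinFact S W :=
  tensorDual W ⋙ LinFact.pushforwardFunctor rfl

/-- The functor `X ↦ X ⊗_S φ_* Hom(K, K)` on factorisations. -/
abbrev chainEnd : LinFact S W ⥤ LinFact S W :=
  LinFact.tensorRight (add_zero W)
    (LinFact.pushforward (map_zero (algebraMap S (PS S))) (LinFact.homFact (K S) (K S)))

variable {W} in
/-- The element `x ⊗ k ⊗ ν` of `φ_*((X ⊗_S K) ⊗ K^∨)`. -/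
def elemPsiPhi (X : LinFact S W) (x : X.M) (k : (K S).M) (ν : Module.Dual (PS S) (K S).M) :
    ((chainPhi W ⋙ chainPsi W).obj X).M :=
  LinFact.toPush rfl ((chainPhi W ⋙ tensorDual W).obj X) ((((1 : PS S) ⊗ₜ[S] x) ⊗ₜ[PS S] k) ⊗ₜ[PS S] ν)

variable {W} in
/-- The element `x ⊗ α` of `X ⊗_S φ_* Hom(K, K)`. -/
def elemEnd (X : LinFact S W) (x : X.M) (α : (K S).M →ₗ[PS S] (K S).M) :
    ((chainEnd W).obj X).M :=
  x ⊗ₜ[S] LinFact.toPush (map_zero (algebraMap S (PS S))) (LinFact.homFact (K S) (K S)) α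

/-- `Φ : hmf(S, W) ⥤ hmf(S⟦u, v⟧, W + uv)`, `Φ(X) = X ⊗_S K`. -/
def Phi : hmf S W ⥤ hmf (PS S) (Wuv W) :=
  (finiteRank (PS S) (Wuv W)).lift
    ((finiteRank S W).ι ⋙ HF.induced (chainPhi W) fun h =>
      LinFact.tensorRight_homotopic _ _ (LinFact.baseChange_homotopic h))
    fun X => X.property.baseChange.tensor rfl (koszul_isFiniteRank _ _)

/-- `Ψ : hmf(S⟦u, v⟧, W + uv) ⥤ HF(S, W)`, `Ψ(Y) = φ_*(Y ⊗ K^∨)`. -/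
def Psi : hmf (PS S) (Wuv W) ⥤ HF S W :=
  (finiteRank (PS S) (Wuv W)).ι ⋙ HF.induced (chainPsi W) fun h =>
    LinFact.pushforward_homotopic _ (LinFact.tensorRight_homotopic _ _ h)

end Periodicity

end Knorrer

end

/-! The complex `φ_* Hom(K, K)` is S-linearly homotopy equivalent to S, so tensoring with X gives X
back. Write an endomorphism α of K as a 2×2 matrix with rows (a, b) and (c, e). Its differential has
both diagonal entries uc + vb and off-diagonal entries u(e - a) and v(a - e). Since u, v is a
regular sequence, even cocycles are the scalar matrices, even coboundaries are the scalars in (u,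
v), and odd cohomology vanishes; what remains is S⟦u,v⟧/(u,v) = S, placed in even degree.

The equivalence is explicit. The counit ε(α) = -e(0) and the unit η = -1 satisfy εη = 1 strictly,
and dH + Hd = 1 - ηε for an S-linear odd H built from formal division by u and v
(`endKHomotopy_spec`). Division works because f - f(0) = u f₁ + v f₂ with f₁, f₂ depending
S-linearly on f (`eq_const_add`).

The residue formula is exactly ε: ∂_v(d_K) ∂_u(d_K) projects onto the odd basis vector, so the
supertrace is -e, and the residue symbol with denominators u, v takes the constant term
(`residue_supertrace`).

The map 1 ⊗ ε is strictly natural in X, and G ⊗ H is a homotopy from the identity to the composite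
of 1 ⊗ ε and its inverse. Composing with the strict isomorphism X ⊗ K ⊗ K^∨ ≅ X ⊗ Hom(K, K), which
exists because K is free of finite rank, gives κ. -/

noncomputable section

namespace Knorrer

/-! ### Formal division in S⟦u, v⟧ and evaluation of the residue symbol -/

section PowerSeries

open MvPowerSeries

variable {S : Type u} [CommRing S] {σ : Type*}

/-- The operator `f ↦ (f - f|_{tᵢ = 0}) / tᵢ` on power series. -/
def divX (i : σ) : MvPowerSeries σ S →ₗ[S] MvPowerSeries σ S where
  toFun f := fun n => coeff (n + Finsupp.single i 1) f
  map_add' _ _ := rfl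
  map_smul' _ _ := rfl

theorem coeff_divX (i : σ) (f : MvPowerSeries σ S) (n : σ →₀ ℕ) :
    coeff n (divX i f) = coeff (n + Finsupp.single i 1) f := rfl

theorem divX_X_mul_self (i : σ) (f : MvPowerSeries σ S) : divX i (X i * f) = f := by
  ext n
  rw [coeff_divX, add_comm, X, coeff_add_monomial_mul, one_mul]

theorem coeff_X_mul_of_eq_zero {i : σ} {n : σ →₀ ℕ} (h : n i = 0) (f : MvPowerSeries σ S) :
    coeff n (X i * f) = 0 := by
  classical
  rw [X, coeff_monomial_mul, if_neg]
  intro hle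
  simpa [h] using hle i

theorem coeff_X_mul_divX_of_ne_zero {i : σ} {n : σ →₀ ℕ} (h : n i ≠ 0) (f : MvPowerSeries σ S) :
    coeff n (X i * divX i f) = coeff n f := by
  classical
  have hle : Finsupp.single i 1 ≤ n := by
    simpa [Nat.one_le_iff_ne_zero] using h
  rw [X, coeff_monomial_mul, if_pos hle, one_mul, coeff_divX, tsub_add_cancel_of_le hle]

theorem divX_X_mul_of_ne {i j : σ} (hij : j ≠ i) (f : MvPowerSeries σ S) :
    divX i (X j * f) = X j * divX i f := by
  classical
  ext n
  have hle : Finsupp.single j 1 ≤ n + Finsupp.single i 1 ↔ Finsupp.single j 1 ≤ n := by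
    simp [hij]
  rw [coeff_divX, X, coeff_monomial_mul, coeff_monomial_mul]
  by_cases h : Finsupp.single j 1 ≤ n
  · rw [if_pos (hle.2 h), if_pos h, coeff_divX, tsub_add_eq_add_tsub h]
  · rw [if_neg (mt hle.1 h), if_neg h]

/-- Every power series in `u, v` is its constant term plus a combination of `u` and `v`. -/
theorem eq_const_add (f : PS S) :
    uVar S * divX 0 f + vVar S * divX 1 (f - uVar S * divX 0 f) =
      f - algebraMap S (PS S) (constantCoeff f) := by
  classical
  ext n
  rw [map_add, map_sub (coeff n), MvPowerSeries.algebraMap_apply, Algebra.algebraMap_self_apply]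
  -- The first summand collects the monomials divisible by u, the second those free of u and
  -- divisible by v; only the exponent 0 is missed.
  by_cases h0 : n 0 = 0
  · rw [coeff_X_mul_of_eq_zero h0, zero_add]
    by_cases h1 : n 1 = 0
    · have hn : n = 0 := by
        ext i
        fin_cases i <;> assumption
      rw [coeff_X_mul_of_eq_zero h1]
      subst hn
      simp
    · have hn : n ≠ 0 := fun h => h1 (by simp [h])
      rw [coeff_X_mul_divX_of_ne_zero h1, map_sub, coeff_X_mul_of_eq_zero h0, coeff_C, if_neg hn]
  · have hn : n ≠ 0 := fun h => h0 (by simp [h])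
    rw [coeff_X_mul_divX_of_ne_zero h0, coeff_C, if_neg hn]
    by_cases h1 : n 1 = 0
    · rw [coeff_X_mul_of_eq_zero h1]
      simp
    · rw [coeff_X_mul_divX_of_ne_zero h1, map_sub, coeff_X_mul_divX_of_ne_zero h0]
      simp

/-- The decomposition `eq_const_add` exhibits a series without constant term as a combination of u
and v. -/
theorem mem_varIdeal_two (f : PS S) : f ∈ varIdeal S 2 ↔ constantCoeff f = 0 := by
  constructor
  · intro hf
    have : varIdeal S 2 ≤ RingHom.ker (constantCoeff (σ := Fin 2) (R := S)) := by
      rw [Ideal.span_le]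
      rintro _ ⟨i, rfl⟩
      simp [RingHom.mem_ker]
    exact RingHom.mem_ker.1 (this hf)
  · intro hf
    have h := eq_const_add f
    rw [hf, map_zero, sub_zero] at h
    rw [← h]
    exact add_mem (Ideal.mul_mem_right _ _ (Ideal.subset_span ⟨0, rfl⟩))
      (Ideal.mul_mem_right _ _ (Ideal.subset_span ⟨1, rfl⟩))

/-- Evaluation at the origin identifies `S⟦u, v⟧ / (u, v)` with `S`. -/
def quotEquiv : (PS S ⧸ varIdeal S 2) ≃ₗ[S] S :=
  LinearEquiv.ofBijective
    (Ideal.Quotient.liftₐ (varIdeal S 2)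
      ({ constantCoeff (σ := Fin 2) (R := S) with
          commutes' := fun s => by simp [MvPowerSeries.algebraMap_apply] } : PS S →ₐ[S] S)
      fun f hf => (mem_varIdeal_two f).1 hf).toLinearMap
    (by
      constructor
      · rw [← LinearMap.ker_eq_bot, LinearMap.ker_eq_bot']
        intro q hq
        obtain ⟨f, rfl⟩ := Ideal.Quotient.mk_surjective q
        exact Ideal.Quotient.eq_zero_iff_mem.2 ((mem_varIdeal_two f).2 hq)
      · intro s
        exact ⟨Ideal.Quotient.mk _ (C s), constantCoeff_C (σ := Fin 2) s⟩)

theorem quotEquiv_mk (f : PS S) :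
    quotEquiv (Ideal.Quotient.mk (varIdeal S 2) f) = constantCoeff f := rfl

/-- By the Leibniz rule the commutator [∂ᵢ, r] is multiplication by ∂ᵢ r. -/
theorem quotComm_mk {n : ℕ} (i : Fin n) (r a : MvPowerSeries (Fin n) S) :
    quotComm i r (Ideal.Quotient.mk (varIdeal S n) a) =
      Ideal.Quotient.mk (varIdeal S n) (pderiv S i r * a) := by
  rw [← pderivComm_apply]
  rfl

theorem quotComm_X_self {n : ℕ} (i : Fin n) : quotComm (S := S) i (X i) = 1 := by
  refine LinearMap.ext fun q => ?_
  obtain ⟨a, rfl⟩ := Ideal.Quotient.mk_surjective q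
  rw [quotComm_mk, pderiv_X_self, one_mul]
  rfl

theorem quotComm_X_of_ne {n : ℕ} {i j : Fin n} (h : j ≠ i) : quotComm (S := S) i (X j) = 0 := by
  refine LinearMap.ext fun q => ?_
  obtain ⟨a, rfl⟩ := Ideal.Quotient.mk_surjective q
  rw [quotComm_mk, pderiv_X_of_ne h, zero_mul]
  rfl

theorem mulLeft_mk (f : PS S) :
    LinearMap.mulLeft S (Ideal.Quotient.mk (varIdeal S 2) f) =
      constantCoeff f • (1 : Module.End S (PS S ⧸ varIdeal S 2)) := by
  refine LinearMap.ext fun q => ?_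
  obtain ⟨a, rfl⟩ := Ideal.Quotient.mk_surjective q
  apply quotEquiv.injective
  rw [LinearMap.smul_apply, map_smul, LinearMap.mulLeft_apply, ← map_mul, quotEquiv_mk, map_mul]
  rfl

/-- The residue symbol of `f du ∧ dv` with denominators `u, v` is the constant term of `f`. -/
theorem residue_uv (f : PS S) : residue f ![uVar S, vVar S] = constantCoeff f := by
  have hu : (Finset.univ : Finset (Equiv.Perm (Fin 2))) = {1, Equiv.swap 0 1} := by decide
  have hne : (1 : Equiv.Perm (Fin 2)) ≠ Equiv.swap 0 1 := by decide
  have key : (∑ τ : Equiv.Perm (Fin 2), (Equiv.Perm.sign τ : ℤ) •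
      (LinearMap.mulLeft S (Ideal.Quotient.mk (varIdeal S 2) f) *
        (List.ofFn fun i => quotComm (τ i) (![uVar S, vVar S] i)).prod)) =
      constantCoeff f • (1 : Module.End S (PS S ⧸ varIdeal S 2)) := by
    rw [hu, Finset.sum_pair hne, mulLeft_mk]
    -- The transposition contributes a product containing [∂_v, u], which vanishes; the identity
    -- contributes multiplication by f.
    have h0 : quotComm (S := S) (n := 2) 1 (uVar S) = 0 := quotComm_X_of_ne (by decide)
    simp [List.ofFn_succ, quotComm_X_self, h0]
  rw [residue, key, map_smul, ← LinearMap.trace_conj' _ quotEquiv]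
  have h1 : quotEquiv.conj (1 : Module.End S (PS S ⧸ varIdeal S 2)) = LinearMap.id :=
    LinearEquiv.conj_id _
  rw [h1, LinearMap.trace_id]
  -- The trace of the identity is the rank of S over itself, which is 1 only when S is nontrivial;
  -- over the zero ring the equation is vacuous.
  cases subsingleton_or_nontrivial S
  · exact Subsingleton.elim _ _
  · simp

end PowerSeries

/-! ### The canonical isomorphism X ⊗ Y ⊗ Y^∨ ≅ X ⊗ Hom(Y, Y) -/

namespace LinFact

/-- The isomorphism of factorisations given by a bijective morphism. -/
def isoOfLinearEquiv {R : Type u} [CommRing R] {W : R} {X Y : LinFact R W} (f : X ⟶ Y)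
    (e : X.M ≃ₗ[R] Y.M) (h : f.hom = e.toLinearMap) : X ≅ Y where
  hom := f
  inv := LinFact.Hom.mk e.symm.toLinearMap
    (LinearMap.ext fun y => e.injective (by
      have := f.p_hom (e.symm y)
      simp only [h, LinearEquiv.coe_coe, e.apply_symm_apply] at this
      simp [this]))
    (LinearMap.ext fun y => e.injective (by
      have := f.d_hom (e.symm y)
      simp only [h, LinearEquiv.coe_coe, e.apply_symm_apply] at this
      simp [this]))
  hom_inv_id := LinFact.hom_ext (by ext x; simp [h])
  inv_hom_id := LinFact.hom_ext (by ext x; simp [h])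

theorem tensor_G_tmul {R : Type u} [CommRing R] {W V U : R} (h : W + V = U) (X : LinFact R W)
    (Y : LinFact R V) (x : X.M) (y : Y.M) : (tensor h X Y).G (x ⊗ₜ y) = X.G x ⊗ₜ Y.G y := by
  refine (G_apply _ _).trans ?_
  simp [G_apply, tmul_sub, sub_tmul]
  abel

theorem baseChange_G_tmul {R S : Type u} [CommRing R] [CommRing S] [Algebra S R] {W : S}
    (X : LinFact S W) (r : R) (x : X.M) :
    (X.baseChange (R := R)).G (r ⊗ₜ x) = r ⊗ₜ X.G x := by
  refine (G_apply _ _).trans ?_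
  simp [G_apply, tmul_sub]

section Canonical

variable {S R : Type u} [CommRing S] [CommRing R] [Algebra S R] {W : S} {V U : R}
  (h₁ : algebraMap S R W + V = U) (h₂ : U + -V = algebraMap S R W)
  (X : LinFact S W) (Y : LinFact R V)

/-- The factorisation `X ⊗_S Y ⊗_R Y^∨` over `R`. -/
abbrev tensorDouble : LinFact R (algebraMap S R W) :=
  tensor h₂ (tensor h₁ X.baseChange Y) Y.dual

/-- The factorisation `φ_* Hom(Y, Y)` of zero. -/
abbrev pushEnd : LinFact S (0 : S) :=
  pushforward (map_zero (algebraMap S R)) (homFact Y Y)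

/-- The element `x ⊗ y ⊗ ν` of `φ_* (X ⊗ Y ⊗ Y^∨)`. -/
abbrev tripleTmul (x : X.M) (y : Y.M) (ν : Module.Dual R Y.M) :
    (pushforward rfl (tensorDouble h₁ h₂ X Y)).M :=
  toPush rfl (tensorDouble h₁ h₂ X Y) ((((1 : R) ⊗ₜ[S] x) ⊗ₜ[R] y) ⊗ₜ[R] ν)

/-- The element `x ⊗ α` of `X ⊗ φ_* Hom(Y, Y)`. -/
abbrev endTmul (x : X.M) (α : Y.M →ₗ[R] Y.M) : (tensor (add_zero W) X (pushEnd (S := S) Y)).M :=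
  x ⊗ₜ[S] toPush (map_zero (algebraMap S R)) (homFact Y Y) α

section Equiv

variable [Module.Finite R Y.M] [Module.Free R Y.M]

/-- The linear isomorphism underlying `X ⊗ Y ⊗ Y^∨ ≅ X ⊗ Hom(Y, Y)`. -/
def canonEquiv : (pushforward rfl (tensorDouble h₁ h₂ X Y)).M ≃ₗ[S]
    (tensor (add_zero W) X (pushEnd (S := S) Y)).M :=
  letI : Module R (pushEnd (S := S) Y).M := inferInstanceAs (Module R (Y.M →ₗ[R] Y.M))
  haveI : IsScalarTower S R (pushEnd (S := S) Y).M :=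
    IsScalarTower.of_algebraMap_smul fun _ _ => rfl
  let e : (tensorDouble h₁ h₂ X Y).M ≃ₗ[R] (pushEnd (S := S) Y).M ⊗[S] X.M :=
    TensorProduct.assoc R (R ⊗[S] X.M) Y.M (Module.Dual R Y.M) ≪≫ₗ
    TensorProduct.congr (LinearEquiv.refl R (R ⊗[S] X.M))
      ((TensorProduct.comm _ _ _ ≪≫ₗ dualTensorHomEquiv (R := R) (M := Y.M) (N := Y.M) :
          (Y.M ⊗[R] (Module.Dual R Y.M)) ≃ₗ[R] (pushEnd (S := S) Y).M)) ≪≫ₗ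
    TensorProduct.comm R (R ⊗[S] X.M) (pushEnd (S := S) Y).M ≪≫ₗ
    TensorProduct.AlgebraTensorModule.cancelBaseChange S R R (pushEnd (S := S) Y).M X.M
  -- The S-action on a pushforward is the R-action through the structure map, so the R-linear `e` is
  -- S-linear.
  let e' : (pushforward rfl (tensorDouble h₁ h₂ X Y)).M ≃ₗ[S] (pushEnd (S := S) Y).M ⊗[S] X.M :=
    { (toPush rfl (tensorDouble h₁ h₂ X Y)).symm.trans e.toAddEquiv with
      map_smul' := fun s y =>
        (map_smul e (algebraMap S R s) ((toPush rfl (tensorDouble h₁ h₂ X Y)).symm y)).trans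
          (algebraMap_smul R s _) }
  e' ≪≫ₗ TensorProduct.comm S (pushEnd (S := S) Y).M X.M

theorem canonEquiv_tripleTmul (x : X.M) (y : Y.M) (ν : Module.Dual R Y.M) :
    canonEquiv h₁ h₂ X Y (tripleTmul h₁ h₂ X Y x y ν) = endTmul X Y x (ν.smulRight y) := by
  let : Module R (pushEnd (S := S) Y).M := inferInstanceAs (Module R (Y.M →ₗ[R] Y.M))
  change x ⊗ₜ[S] ((1 : R) • toPush (map_zero (algebraMap S R)) (homFact Y Y)
    (dualTensorHom R Y.M Y.M (ν ⊗ₜ y))) = _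
  rw [one_smul]
  rfl

end Equiv

variable {X Y} in
-- The elements x ⊗ y ⊗ ν generate additively, although the base change R ⊗ X contains more than the
-- 1 ⊗ x.
theorem tripleTmul_lin_ext {N : Type*} [AddCommGroup N] [Module S N]
    {f g : (pushforward rfl (tensorDouble h₁ h₂ X Y)).M →ₗ[S] N}
    (h : ∀ x y ν, f (tripleTmul h₁ h₂ X Y x y ν) = g (tripleTmul h₁ h₂ X Y x y ν)) : f = g := by
  let T := toPush rfl (tensorDouble h₁ h₂ X Y)
  suffices main : ∀ z : ((R ⊗[S] X.M) ⊗[R] Y.M) ⊗[R] Module.Dual R Y.M, f (T z) = g (T z) from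
    LinearMap.ext fun z => main (T.symm z)
  intro z
  induction z with
  | zero => rw [map_zero, map_zero, map_zero]
  | add a b ha hb => rw [map_add, map_add, map_add, ha, hb]
  | tmul a ν =>
    induction a with
    | zero => rw [zero_tmul, map_zero, map_zero, map_zero]
    | add a b ha hb => rw [add_tmul, map_add, map_add, map_add, ha, hb]
    | tmul a y =>
      induction a with
      | zero => rw [zero_tmul, zero_tmul, map_zero, map_zero, map_zero]
      | add a b ha hb => rw [add_tmul, add_tmul, map_add, map_add, map_add, ha, hb]
      | tmul r x =>
        -- A coefficient from R moves across the tensor product onto y.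
        have e : (r ⊗ₜ[S] x) ⊗ₜ[R] y = ((1 : R) ⊗ₜ[S] x) ⊗ₜ[R] (r • y) := by
          rw [← smul_tmul, smul_tmul', smul_eq_mul, mul_one]
        rw [e]
        exact h x (r • y) ν

theorem p_tripleTmul (x : X.M) (y : Y.M) (ν : Module.Dual R Y.M) :
    (pushforward rfl (tensorDouble h₁ h₂ X Y)).p (tripleTmul h₁ h₂ X Y x y ν) =
      tripleTmul h₁ h₂ X Y (X.p x) (Y.p y) (Y.dual.p ν) +
      tripleTmul h₁ h₂ X Y (x - X.p x) (y - Y.p y) (Y.dual.p ν) +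
      tripleTmul h₁ h₂ X Y (X.p x) (y - Y.p y) (ν - Y.dual.p ν) +
      tripleTmul h₁ h₂ X Y (x - X.p x) (Y.p y) (ν - Y.dual.p ν) := by
  refine (toPush_p rfl (tensorDouble h₁ h₂ X Y) _).trans ?_
  rw [tripleTmul, tripleTmul, tripleTmul, tripleTmul, ← map_add, ← map_add, ← map_add]
  congr 1
  simp [tmul_sub, sub_tmul, add_tmul]
  abel

theorem d_tripleTmul (x : X.M) (y : Y.M) (ν : Module.Dual R Y.M) :
    (pushforward rfl (tensorDouble h₁ h₂ X Y)).d (tripleTmul h₁ h₂ X Y x y ν) =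
      tripleTmul h₁ h₂ X Y (X.d x) y ν + tripleTmul h₁ h₂ X Y (X.G x) (Y.d y) ν +
        tripleTmul h₁ h₂ X Y (X.G x) (Y.G y) (Y.dual.d ν) := by
  refine (toPush_d rfl (tensorDouble h₁ h₂ X Y) _).trans ?_
  rw [tripleTmul, tripleTmul, tripleTmul, ← map_add, ← map_add]
  congr 1
  -- The Koszul sign for moving d past x ⊗ y is the grading operator of the tensor product, which
  -- factors as G ⊗ G.
  have g₁ := baseChange_G_tmul X (1 : R) x
  have g₂ := tensor_G_tmul h₁ X.baseChange Y ((1 : R) ⊗ₜ x) y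
  rw [g₁] at g₂
  refine Eq.trans ?_ (congrArg₂ (fun a b => ((((1 : R) ⊗ₜ[S] X.d x) ⊗ₜ[R] y) ⊗ₜ[R] ν +
    (a ⊗ₜ[R] Y.d y) ⊗ₜ[R] ν) +
    b ⊗ₜ[R] Y.dual.d ν) g₁ g₂)
  exact congrArg (fun a => a + (tensor h₁ X.baseChange Y).G (((1 : R) ⊗ₜ[S] x) ⊗ₜ[R] y) ⊗ₜ[R]
    Y.dual.d ν) (add_tmul (((1 : R) ⊗ₜ[S] X.d x) ⊗ₜ[R] y)
      ((X.baseChange (R := R)).G ((1 : R) ⊗ₜ[S] x) ⊗ₜ[R] Y.d y) ν)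

theorem p_endTmul (x : X.M) (α : Y.M →ₗ[R] Y.M) :
    (tensor (add_zero W) X (pushEnd (S := S) Y)).p (endTmul X Y x α) =
      endTmul X Y (X.p x) ((homFact Y Y).p α) +
        endTmul X Y (x - X.p x) (α - (homFact Y Y).p α) := rfl

theorem d_endTmul (x : X.M) (α : Y.M →ₗ[R] Y.M) :
    (tensor (add_zero W) X (pushEnd (S := S) Y)).d (endTmul X Y x α) =
      endTmul X Y (X.d x) α + endTmul X Y (X.G x) ((homFact Y Y).d α) := rfl

theorem endTmul_add (x : X.M) (α β : Y.M →ₗ[R] Y.M) :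
    endTmul X Y x (α + β) = endTmul X Y x α + endTmul X Y x β := by
  rw [endTmul, map_add, tmul_add]

variable [Module.Finite R Y.M] [Module.Free R Y.M]

/-- The canonical morphism `X ⊗ Y ⊗ Y^∨ ⟶ X ⊗ Hom(Y, Y)`. -/
def canonHom : Hom (pushforward rfl (tensorDouble h₁ h₂ X Y))
    (tensor (add_zero W) X (pushEnd (S := S) Y)) where
  hom := (canonEquiv h₁ h₂ X Y).toLinearMap
  comm_p := by
    refine tripleTmul_lin_ext h₁ h₂ fun x y ν => ?_
    -- A rank one map ν(-)y is even when ν and y have equal parity.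
    have e₁ : (homFact Y Y).p (ν.smulRight y) =
        (Y.dual.p ν).smulRight (Y.p y) + (ν - Y.dual.p ν).smulRight (y - Y.p y) := by
      refine LinearMap.ext fun z => ?_
      simp [Module.Dual.transpose_apply, sub_smul, smul_sub]
    have e₂ : ν.smulRight y - (homFact Y Y).p (ν.smulRight y) =
        (Y.dual.p ν).smulRight (y - Y.p y) + (ν - Y.dual.p ν).smulRight (Y.p y) := by
      rw [e₁]
      refine LinearMap.ext fun z => ?_
      simp [sub_smul, smul_sub]
      abel
    rw [LinearMap.comp_apply, LinearMap.comp_apply, p_tripleTmul, LinearEquiv.coe_coe,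
      map_add, map_add, map_add, canonEquiv_tripleTmul, canonEquiv_tripleTmul,
      canonEquiv_tripleTmul, canonEquiv_tripleTmul, canonEquiv_tripleTmul, p_endTmul, e₂, e₁,
      endTmul_add, endTmul_add]
    abel
  comm_d := by
    refine tripleTmul_lin_ext h₁ h₂ fun x y ν => ?_
    -- The sign -(-1)^{|α|} with |α| = |y| + |ν| splits into G on y and the sign in the dual
    -- differential, so the canonical map needs no extra sign.
    have e : (homFact Y Y).d (ν.smulRight y) =
        ν.smulRight (Y.d y) + (Y.dual.d ν).smulRight (Y.G y) := by
      refine LinearMap.ext fun z => ?_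
      simp [Module.Dual.transpose_apply, sub_eq_add_neg]
    rw [LinearMap.comp_apply, LinearMap.comp_apply, d_tripleTmul, LinearEquiv.coe_coe,
      map_add, map_add, canonEquiv_tripleTmul, canonEquiv_tripleTmul, canonEquiv_tripleTmul,
      canonEquiv_tripleTmul, d_endTmul, e, endTmul_add, add_assoc]

variable (W) in
/-- The canonical natural isomorphism `X ⊗ Y ⊗ Y^∨ ≅ X ⊗ Hom(Y, Y)`. -/
def canonNatIso : (baseChangeFunctor R W ⋙ tensorRight h₁ Y) ⋙
    (tensorRight h₂ Y.dual ⋙ pushforwardFunctor rfl) ≅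
      tensorRight (add_zero W) (pushEnd (S := S) Y) :=
  NatIso.ofComponents
    (fun X => isoOfLinearEquiv (canonHom h₁ h₂ X Y) (canonEquiv h₁ h₂ X Y) rfl) fun {X X'} f => by
      refine hom_ext (tripleTmul_lin_ext h₁ h₂ fun x k ν => ?_)
      refine (canonEquiv_tripleTmul h₁ h₂ X' Y (f.hom x) k ν).trans ?_
      exact (congrArg (Hom.hom ((tensorRight (add_zero W) (pushEnd (S := S) Y)).map f))
        (canonEquiv_tripleTmul h₁ h₂ X Y x k ν)).symm

theorem canonNatIso_hom_app_tripleTmul (x : X.M) (y : Y.M) (ν : Module.Dual R Y.M) :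
    ((canonNatIso W h₁ h₂ Y).hom.app X).hom (tripleTmul h₁ h₂ X Y x y ν) =
      endTmul X Y x (ν.smulRight y) :=
  canonEquiv_tripleTmul h₁ h₂ X Y x y ν

end Canonical

end LinFact

section CanonicalKoszul

variable {S : Type u} [CommRing S] (W : S)

/-- The canonical natural isomorphism `X ⊗ K ⊗ K^∨ ≅ X ⊗ Hom(K, K)`. -/
def canonIso : chainPhi W ⋙ chainPsi W ≅ chainEnd W :=
  LinFact.canonNatIso W rfl (add_neg_cancel_right _ _) (K S)

theorem canonIso_elem (X : LinFact S W) (x : X.M) (k : (K S).M)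
    (ν : Module.Dual (PS S) (K S).M) :
    ((canonIso W).hom.app X).hom (elemPsiPhi X x k ν) = elemEnd X x (ν.smulRight k) :=
  LinFact.canonNatIso_hom_app_tripleTmul rfl (add_neg_cancel_right _ _) X (K S) x k ν

end CanonicalKoszul

/-! ### The deformation retraction of Hom(K, K) onto S -/

section Retract

variable {S : Type u} [CommRing S]

theorem toLin'_fin_two_apply {R : Type*} [CommRing R] (a b c e : R) (z : Fin 2 → R) :
    Matrix.toLin' !![a, b; c, e] z = ![a * z 0 + b * z 1, c * z 0 + e * z 1] := by
  ext i : 1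
  fin_cases i <;> simp [Matrix.toLin'_apply', Matrix.mulVec, dotProduct]

theorem K_p_apply (z : (K S).M) : (K S).p z = ![z 0, 0] :=
  (toLin'_fin_two_apply 1 0 0 0 z).trans (by rw [one_mul, zero_mul, zero_mul, add_zero, add_zero])

theorem K_d_apply (z : (K S).M) : (K S).d z = ![uVar S * z 1, vVar S * z 0] :=
  (toLin'_fin_two_apply 0 (uVar S) (vVar S) 0 z).trans
    (by rw [zero_mul, zero_mul, zero_add, add_zero])

theorem K_G_apply (z : (K S).M) : (K S).G z = ![z 0, -z 1] := by
  refine ((K S).G_apply z).trans ?_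
  rw [K_p_apply]
  ext i : 1
  fin_cases i
  · change z 0 - (z 0 - z 0) = z 0
    ring
  · change 0 - (z 1 - 0) = -z 1
    ring

/-- The endomorphism of `K` with the given matrix entries. -/
def endMk (a b c e : PS S) : (K S).M →ₗ[PS S] (K S).M := Matrix.toLin' !![a, b; c, e]

theorem endMk_apply (a b c e : PS S) (z : (K S).M) :
    endMk a b c e z = ![a * z 0 + b * z 1, c * z 0 + e * z 1] :=
  toLin'_fin_two_apply a b c e z

/-- The matrix entry of an endomorphism of `K`. -/
def entry (i j : Fin 2) (α : (K S).M →ₗ[PS S] (K S).M) : PS S := α (Pi.single j 1) i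

theorem entry_endMk_zero_one (a b c e : PS S) : entry 0 1 (endMk a b c e) = b := by
  simp [entry, endMk]

theorem entry_endMk_one_one (a b c e : PS S) : entry 1 1 (endMk a b c e) = e := by
  simp [entry, endMk]

theorem endMk_entry (α : (K S).M →ₗ[PS S] (K S).M) :
    endMk (entry 0 0 α) (entry 0 1 α) (entry 1 0 α) (entry 1 1 α) = α := by
  refine LinearMap.pi_ext' fun j => LinearMap.ext_ring (funext fun i => ?_)
  fin_cases i <;> fin_cases j <;> simp [endMk, entry]

theorem endMk_add (a b c e a' b' c' e' : PS S) :
    endMk a b c e + endMk a' b' c' e' = endMk (a + a') (b + b') (c + c') (e + e') := by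
  simp [endMk, ← map_add]

theorem endMk_sub (a b c e a' b' c' e' : PS S) :
    endMk a b c e - endMk a' b' c' e' = endMk (a - a') (b - b') (c - c') (e - e') := by
  simp [endMk, ← map_sub]

theorem endMk_smul (r a b c e : PS S) :
    r • endMk a b c e = endMk (r * a) (r * b) (r * c) (r * e) := by
  simp [endMk, ← map_smul]

theorem endMk_zero : endMk (S := S) 0 0 0 0 = 0 := by
  refine LinearMap.ext fun z => ?_
  rw [endMk_apply, zero_mul, zero_mul, add_zero]
  ext i : 1
  fin_cases i <;> rfl

theorem homFact_p_endMk (a b c e : PS S) :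
    (LinFact.homFact (K S) (K S)).p (endMk a b c e) = endMk a 0 0 e := by
  refine LinearMap.ext fun z => ?_
  change (K S).p (endMk a b c e ((K S).p z)) +
    (endMk a b c e (z - (K S).p z) - (K S).p (endMk a b c e (z - (K S).p z))) = _
  rw [K_p_apply, K_p_apply, K_p_apply, endMk_apply, endMk_apply, endMk_apply]
  ext i : 1
  fin_cases i <;> simp

theorem homFact_d_endMk (a b c e : PS S) :
    (LinFact.homFact (K S) (K S)).d (endMk a b c e) =
      endMk (uVar S * c + vVar S * b) (uVar S * (e - a)) (vVar S * (a - e))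
        (uVar S * c + vVar S * b) := by
  refine LinearMap.ext fun z => ?_
  change (K S).d (endMk a b c e z) - (K S).G (endMk a b c e ((K S).G ((K S).d z))) = _
  rw [K_d_apply, K_d_apply, K_G_apply, K_G_apply, endMk_apply, endMk_apply, endMk_apply]
  ext i : 1
  fin_cases i <;> simp <;> ring

variable (S) in
/-- The factorisation `φ_* Hom(K, K)` of zero. -/
abbrev endK : LinFact S (0 : S) :=
  LinFact.pushforward (map_zero (algebraMap S (PS S))) (LinFact.homFact (K S) (K S))

variable (S) in
/-- An endomorphism of `K`, regarded as an element of `φ_* Hom(K, K)`. -/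
abbrev toEndK : ((K S).M →ₗ[PS S] (K S).M) ≃+ (endK S).M :=
  LinFact.toPush (map_zero (algebraMap S (PS S))) (LinFact.homFact (K S) (K S))

theorem toEndK_smul (s : S) (α : (K S).M →ₗ[PS S] (K S).M) :
    s • toEndK S α = toEndK S (algebraMap S (PS S) s • α) := rfl

/-- Reduces identities on the pushforward to computations with four matrix entries. -/
theorem endK_cases {P : (endK S).M → Prop}
    (h : ∀ a b c e : PS S, P (toEndK S (endMk a b c e))) (y) : P y := by
  obtain ⟨α, rfl⟩ := (toEndK S).surjective y
  rw [← endMk_entry α]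
  exact h _ _ _ _

theorem endK_p (a b c e : PS S) :
    (endK S).p (toEndK S (endMk a b c e)) = toEndK S (endMk a 0 0 e) :=
  congrArg (toEndK S) (homFact_p_endMk a b c e)

theorem endK_d (a b c e : PS S) : (endK S).d (toEndK S (endMk a b c e)) =
    toEndK S (endMk (uVar S * c + vVar S * b) (uVar S * (e - a)) (vVar S * (a - e))
        (uVar S * c + vVar S * b)) :=
  congrArg (toEndK S) (homFact_d_endMk a b c e)

/-- Minus the constant term of the lower right entry. -/
def counitFun (α : (K S).M →ₗ[PS S] (K S).M) : S :=
  -MvPowerSeries.constantCoeff (entry 1 1 α)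

theorem counitFun_endMk (a b c e : PS S) :
    counitFun (endMk a b c e) = -MvPowerSeries.constantCoeff e := by
  rw [counitFun, entry_endMk_one_one]

/-- The contracting homotopy of `φ_* Hom(K, K)` onto `S`, on endomorphisms of `K`. -/
def contract (α : (K S).M →ₗ[PS S] (K S).M) : (K S).M →ₗ[PS S] (K S).M :=
  endMk (-divX 0 (entry 0 1 α)) (divX 1 (entry 1 1 α - uVar S * divX 0 (entry 1 1 α)))
    (divX 0 (entry 1 1 α)) 0

theorem contract_endMk (a b c e : PS S) : contract (endMk a b c e) =
    endMk (-divX 0 b) (divX 1 (e - uVar S * divX 0 e)) (divX 0 e) 0 := by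
  rw [contract, entry_endMk_zero_one, entry_endMk_one_one]

variable (S) in
/-- The morphism of complexes `φ_* Hom(K, K) → S` given by minus the constant term of the lower
right entry. -/
def endKCounit : (endK S).M →ₗ[S] S where
  toFun y := counitFun ((toEndK S).symm y)
  map_add' y y' := by
    induction y using endK_cases with | h a b c e
    induction y' using endK_cases with | h a' b' c' e'
    rw [← map_add, AddEquiv.symm_apply_apply, AddEquiv.symm_apply_apply, AddEquiv.symm_apply_apply,
      endMk_add, counitFun_endMk, counitFun_endMk, counitFun_endMk, map_add, neg_add]
  map_smul' s y := by
    induction y using endK_cases with | h a b c e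
    rw [toEndK_smul, AddEquiv.symm_apply_apply, AddEquiv.symm_apply_apply, endMk_smul,
      counitFun_endMk, counitFun_endMk, map_mul, MvPowerSeries.algebraMap_apply,
      MvPowerSeries.constantCoeff_C, RingHom.id_apply, smul_eq_mul, mul_neg]
    rfl

theorem endKCounit_apply (a b c e : PS S) :
    endKCounit S (toEndK S (endMk a b c e)) = -MvPowerSeries.constantCoeff e :=
  counitFun_endMk a b c e

variable (S) in
/-- The contracting homotopy of `φ_* Hom(K, K)` onto `S`. -/
def endKHomotopy : Module.End S (endK S).M where
  toFun y := toEndK S (contract ((toEndK S).symm y))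
  map_add' y y' := by
    induction y using endK_cases with | h a b c e
    induction y' using endK_cases with | h a' b' c' e'
    rw [← map_add, AddEquiv.symm_apply_apply, AddEquiv.symm_apply_apply, AddEquiv.symm_apply_apply,
      endMk_add, contract_endMk, contract_endMk, contract_endMk, ← map_add, endMk_add]
    simp only [map_add, map_sub, mul_add, add_zero]
    congr 2 <;> abel
  map_smul' s y := by
    induction y using endK_cases with | h a b c e
    rw [toEndK_smul, AddEquiv.symm_apply_apply, AddEquiv.symm_apply_apply, endMk_smul,
      contract_endMk, contract_endMk, RingHom.id_apply, toEndK_smul, endMk_smul]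
    simp only [← Algebra.smul_def, map_smul, mul_smul_comm, ← smul_sub, smul_neg, smul_zero]

theorem endKHomotopy_apply (a b c e : PS S) :
    endKHomotopy S (toEndK S (endMk a b c e)) =
      toEndK S (endMk (-divX 0 b) (divX 1 (e - uVar S * divX 0 e)) (divX 0 e) 0) :=
  congrArg (toEndK S) (contract_endMk a b c e)

theorem endKHomotopy_odd (y : (endK S).M) :
    (endK S).p (endKHomotopy S y) = endKHomotopy S (y - (endK S).p y) := by
  induction y using endK_cases with | h a b c e
  rw [endK_p, ← map_sub, endMk_sub, endKHomotopy_apply, endKHomotopy_apply, endK_p]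
  simp

theorem endKCounit_p (y : (endK S).M) : endKCounit S ((endK S).p y) = endKCounit S y := by
  induction y using endK_cases with | h a b c e
  rw [endK_p, endKCounit_apply, endKCounit_apply]

/-- The diagonal entry uc + vb of a coboundary has no constant term. -/
theorem endKCounit_d (y : (endK S).M) : endKCounit S ((endK S).d y) = 0 := by
  induction y using endK_cases with | h a b c e
  rw [endK_d, endKCounit_apply]
  simp

variable (S) in
/-- The element `-1` of `φ_* Hom(K, K)`. -/
def endKUnit : (endK S).M := toEndK S (endMk (-1) 0 0 (-1))

theorem endK_p_unit : (endK S).p (endKUnit S) = endKUnit S := endK_p _ _ _ _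

theorem endK_d_unit : (endK S).d (endKUnit S) = 0 := by
  rw [endKUnit, endK_d, ← map_zero (toEndK S), ← endMk_zero]
  simp

/-- The sign of the unit -1 compensates the minus sign that the supertrace puts into the counit. -/
theorem endKCounit_unit : endKCounit S (endKUnit S) = 1 := by
  rw [endKUnit, endKCounit_apply]
  simp

/-- In H the off-diagonal entries are the two quotients of e, so dH has diagonal e - e(0) by
`eq_const_add`. The upper left entry -b/u (formal quotient) gives dH off-diagonal entries that
cancel the error in Hd, where b and c are recovered from uc + vb only up to multiples of u and v. -/
theorem endKHomotopy_spec (y : (endK S).M) :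
    (endK S).d (endKHomotopy S y) + endKHomotopy S ((endK S).d y) =
      y - endKCounit S y • endKUnit S := by
  induction y using endK_cases with | h a b c e
  rw [endKHomotopy_apply, endK_d, endK_d, endKHomotopy_apply, endKCounit_apply, endKUnit,
    toEndK_smul, ← map_add, ← map_sub, endMk_add, endMk_smul, endMk_sub]
  have h₁ := eq_const_add e
  -- Formal division by u commutes with multiplication by v, leaving the cross term v · (b/u).
  have h₂ : divX 0 (uVar S * c + vVar S * b) = c + vVar S * divX 0 b :=
    (map_add _ _ _).trans
      (congrArg₂ _ (divX_X_mul_self _ _) (divX_X_mul_of_ne (by decide) _))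
  have h₃ : divX 0 (uVar S * (e - a)) = e - a := divX_X_mul_self _ _
  -- After the part divisible by u is removed, v(b - u · (b/u)) remains.
  have h₄ : divX 1 (uVar S * c + vVar S * b - uVar S * (c + vVar S * divX 0 b)) =
      b - uVar S * divX 0 b := by
    refine Eq.trans ?_ (divX_X_mul_self (S := S) 1 (b - uVar S * divX 0 b))
    congr 1
    ring
  rw [h₂, h₃, h₄, h₁, map_neg]
  congr 2 <;> ring

/-- The derivatives in u and v are the matrix units E₀₁ and E₁₀, and E₁₀E₀₁ = E₁₁ projects onto the
odd basis vector. -/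
theorem dKv_dKu : dKv S ∘ₗ dKu S = endMk 0 0 0 1 := by
  have h₁ : MvPowerSeries.pderiv S 0 (vVar S) = 0 := MvPowerSeries.pderiv_X_of_ne (by decide)
  have h₂ : MvPowerSeries.pderiv S 1 (uVar S) = 0 := MvPowerSeries.pderiv_X_of_ne (by decide)
  rw [dKv, dKu, ← Matrix.toLin'_mul, endMk]
  congr 1
  ext i j : 2
  fin_cases i <;> fin_cases j <;>
    simp [koszulMatrix, Matrix.mul_apply, h₁, h₂, MvPowerSeries.pderiv_X_self]

/-- The supertrace in the residue formula. -/
theorem supertrace_dK (α : (K S).M →ₗ[PS S] (K S).M) :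
    LinFact.supertrace (K S) (α ∘ₗ dKv S ∘ₗ dKu S) = -entry 1 1 α := by
  rw [dKv_dKu]
  have h : (K S).G * (α ∘ₗ endMk 0 0 0 1) =
      endMk 0 (entry 0 1 α) 0 (-entry 1 1 α) := by
    refine LinearMap.ext fun z => ?_
    change (K S).G (α (endMk 0 0 0 1 z)) = _
    rw [← endMk_entry α, K_G_apply, endMk_apply, endMk_apply, endMk_apply]
    ext i : 1
    fin_cases i <;> simp [entry_endMk_zero_one, entry_endMk_one_one]
  refine (congrArg (LinearMap.trace (PS S) (Fin 2 → PS S)) h).trans ?_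
  rw [endMk, Matrix.trace_toLin'_eq, Matrix.trace_fin_two_of, zero_add]

/-- Identifies the residue formula with the counit of the retraction. -/
theorem residue_supertrace (α : (K S).M →ₗ[PS S] (K S).M) :
    residue (LinFact.supertrace (K S) (α ∘ₗ dKv S ∘ₗ dKu S)) ![uVar S, vVar S] =
      endKCounit S (toEndK S α) := by
  rw [residue_uv, supertrace_dK, map_neg]
  rfl

end Retract

/-! ### Tensoring the retraction with X, and naturality of κ -/

section Kappa

variable {S : Type u} [CommRing S] {W : S}

/-- The morphism `X ⊗ Hom(K, K) ⟶ X` given by the counit. -/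
def kappaHom (X : LinFact S W) : (chainEnd W).obj X ⟶ X :=
  LinFact.Hom.mk (TensorProduct.rid S X.M ∘ₗ LinearMap.lTensor X.M (endKCounit S))
    (by
      refine TensorProduct.ext' fun x y => ?_
      change X.p (endKCounit S y • x) = TensorProduct.rid S X.M
        (LinearMap.lTensor X.M (endKCounit S)
          (X.p x ⊗ₜ (endK S).p y + (x - X.p x) ⊗ₜ (y - (endK S).p y)))
      -- The counit kills the odd part, so the odd ⊗ odd summand drops out.
      simp [endKCounit_p])
    (by
      refine TensorProduct.ext' fun x y => ?_
      change X.d (endKCounit S y • x) = TensorProduct.rid S X.M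
        (LinearMap.lTensor X.M (endKCounit S) (X.d x ⊗ₜ y + X.G x ⊗ₜ (endK S).d y))
      simp [endKCounit_d])

theorem kappaHom_tmul (X : LinFact S W) (x : X.M) (y : (endK S).M) :
    (kappaHom X).hom (x ⊗ₜ y) = endKCounit S y • x := rfl

/-- The homotopy inverse `X ⟶ X ⊗ Hom(K, K)` of `kappaHom`. -/
def kappaInv (X : LinFact S W) : X ⟶ (chainEnd W).obj X :=
  LinFact.Hom.mk ((TensorProduct.mk S X.M (endK S).M).flip (endKUnit S))
    (by
      refine LinearMap.ext fun x => ?_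
      change X.p x ⊗ₜ (endK S).p (endKUnit S) +
        (x - X.p x) ⊗ₜ (endKUnit S - (endK S).p (endKUnit S)) = X.p x ⊗ₜ[S] endKUnit S
      rw [endK_p_unit, sub_self, tmul_zero, add_zero])
    (by
      refine LinearMap.ext fun x => ?_
      change X.d x ⊗ₜ endKUnit S + X.G x ⊗ₜ (endK S).d (endKUnit S) = X.d x ⊗ₜ[S] endKUnit S
      rw [endK_d_unit, tmul_zero, add_zero])

theorem kappaInv_kappaHom (X : LinFact S W) : kappaInv X ≫ kappaHom X = 𝟙 X := by
  refine LinFact.hom_ext (LinearMap.ext fun x => ?_)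
  change endKCounit S (endKUnit S) • x = x
  rw [endKCounit_unit, one_smul]

theorem LinFact.d_G (X : LinFact S W) (x : X.M) : X.d (X.G x) = -X.G (X.d x) := by
  simp only [G_apply, map_sub, p_d]
  abel

theorem LinFact.G_G (X : LinFact S W) (x : X.M) : X.G (X.G x) = x := by
  simp only [G_apply, map_sub, p_p]
  abel

theorem LinFact.p_G (X : LinFact S W) (x : X.M) : X.p (X.G x) = X.G (X.p x) := by
  simp only [G_apply, map_sub, p_p]

theorem homotopic_kappaHom_kappaInv (X : LinFact S W) :
    LinFact.homotopic S W (𝟙 _) (kappaHom X ≫ kappaInv X) := by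
  -- The factor G is the Koszul sign of the odd map H: since dG + Gd = 0 and G² = 1, the terms with
  -- `X.d` cancel and 1 ⊗ (dH + Hd) is left.
  refine ⟨TensorProduct.map X.G (endKHomotopy S), ?_, ?_⟩
  · refine TensorProduct.ext' fun x y => ?_
    change X.p (X.G x) ⊗ₜ (endK S).p (endKHomotopy S y) + (X.G x - X.p (X.G x)) ⊗ₜ
        (endKHomotopy S y - (endK S).p (endKHomotopy S y)) =
      TensorProduct.map X.G (endKHomotopy S) (x ⊗ₜ[S] y - (X.p x ⊗ₜ (endK S).p y +
        (x - X.p x) ⊗ₜ (y - (endK S).p y)))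
    rw [map_sub, map_add, map_tmul, map_tmul, map_tmul, endKHomotopy_odd, LinFact.p_G,
      map_sub, map_sub]
    simp only [tmul_sub, sub_tmul]
    abel
  · refine TensorProduct.ext' fun x y => ?_
    change x ⊗ₜ[S] y - (endKCounit S y • x) ⊗ₜ endKUnit S =
      X.d (X.G x) ⊗ₜ endKHomotopy S y + X.G (X.G x) ⊗ₜ (endK S).d (endKHomotopy S y) +
      TensorProduct.map X.G (endKHomotopy S) (X.d x ⊗ₜ y + X.G x ⊗ₜ (endK S).d y)
    rw [map_add, map_tmul, map_tmul, smul_tmul, ← tmul_sub, ← endKHomotopy_spec, LinFact.d_G,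
      LinFact.G_G, tmul_add, neg_tmul]
    abel

/-- The isomorphism `X ⊗ Hom(K, K) ≅ X` in the homotopy category. -/
def kappaIso (X : LinFact S W) :
    (HF.quot S W).obj ((chainEnd W).obj X) ≅ (HF.quot S W).obj X where
  hom := (HF.quot S W).map (kappaHom X)
  inv := (HF.quot S W).map (kappaInv X)
  hom_inv_id := by
    rw [← Functor.map_comp, ← CategoryTheory.Functor.map_id]
    exact (CategoryTheory.Quotient.sound _ (homotopic_kappaHom_kappaInv X)).symm
  inv_hom_id := by
    rw [← Functor.map_comp, kappaInv_kappaHom, CategoryTheory.Functor.map_id]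

theorem kappaHom_naturality {X Y : LinFact S W} (f : X ⟶ Y) :
    (chainEnd W).map f ≫ kappaHom Y = kappaHom X ≫ f :=
  LinFact.hom_ext <| TensorProduct.ext' fun x y => (map_smul f.hom (endKCounit S y) x).symm

variable (W) in
/-- The natural isomorphism `κ : Ψ Φ ≅ ι`. -/
def kappa : Phi W ⋙ Psi W ≅ (finiteRank S W).ι :=
  NatIso.ofComponents
    (fun X => (HF.quot S W).mapIso ((canonIso W).app X.obj.as) ≪≫ kappaIso X.obj.as) fun {X Y} f => by
      -- A morphism of `hmf` is a homotopy class; for any representative the square already commutes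
      -- strictly.
      obtain ⟨g, hg⟩ := (HF.quot S W).map_surjective (X := X.obj.as) (Y := Y.obj.as) f.hom
      have h : (chainPhi W ⋙ chainPsi W).map g ≫ (canonIso W).hom.app Y.obj.as ≫ kappaHom Y.obj.as =
          ((canonIso W).hom.app X.obj.as ≫ kappaHom X.obj.as) ≫ g := by
        rw [NatTrans.naturality_assoc, kappaHom_naturality, Category.assoc]
      have h' := congrArg (HF.quot S W).map h
      rw [Functor.map_comp, Functor.map_comp, Functor.map_comp _ _ g, Functor.map_comp] at h'
      have e₁ : (Phi W ⋙ Psi W).map f = (HF.quot S W).map ((chainPhi W ⋙ chainPsi W).map g) := by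
        obtain rfl : f = ObjectProperty.homMk ((HF.quot S W).map g) :=
          ObjectProperty.hom_ext _ hg.symm
        rfl
      have e₂ : (finiteRank S W).ι.map f = (HF.quot S W).map g := hg.symm
      rw [e₁, e₂]
      exact h'

end Kappa

end Knorrer

end

theorem mainTheorem11 {S : Type u} [CommRing S] [Algebra ℚ S] (W : S) :
    ∃ (c : Knorrer.chainPhi W ⋙ Knorrer.chainPsi W ≅ Knorrer.chainEnd W)
      (κ : Knorrer.Phi W ⋙ Knorrer.Psi W ≅ (Knorrer.finiteRank S W).ι),
      -- `c` is the canonical isomorphism `X ⊗ K ⊗ K^∨ ≅ X ⊗ Hom(K, K)`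
      (∀ (X : Knorrer.LinFact S W) (x : X.M) (k : (Knorrer.K S).M)
          (ν : Module.Dual (Knorrer.PS S) (Knorrer.K S).M),
        (c.hom.app X).hom (Knorrer.elemPsiPhi X x k ν) =
          Knorrer.elemEnd X x (ν.smulRight k)) ∧
      -- under `c`, the isomorphism `κ` is the class of the residue formula
      (∀ X : Knorrer.hmf S W, ∃ κX : (Knorrer.chainEnd W).obj X.obj.as ⟶ X.obj.as,
        κ.hom.app X = (Knorrer.HF.quot S W).map (c.hom.app X.obj.as ≫ κX) ∧
        ∀ (x : X.obj.as.M) (α : (Knorrer.K S).M →ₗ[Knorrer.PS S] (Knorrer.K S).M),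
          κX.hom (Knorrer.elemEnd X.obj.as x α) =
            Knorrer.residue
              (Knorrer.LinFact.supertrace (Knorrer.K S) (α ∘ₗ Knorrer.dKv S ∘ₗ Knorrer.dKu S))
              ![Knorrer.uVar S, Knorrer.vVar S] • x) := by
  refine ⟨Knorrer.canonIso W, Knorrer.kappa W, Knorrer.canonIso_elem W, fun X =>
    ⟨Knorrer.kappaHom X.obj.as, ((Knorrer.HF.quot S W).map_comp _ _).symm, fun x α => ?_⟩⟩
  rw [Knorrer.residue_supertrace]
  exact Knorrer.kappaHom_tmul X.obj.as x _
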